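/- Let $B_0\subset\mathbb{E}^3$ be a convex body of constant width $w_0>0$ whose boundary $S_0$ is a $C^2$-smooth surface, and let $r_0:S^2\to\mathbb{R}$ be its support function, so that $r_0(u)+r_0(-u)=w_0$ for all $u\in S^2$. Let $J$ be the set of all $C\in\mathbb{R}$ with $w_0+2C>0$ for which $r_0+C$ is the support function of a convex body, and for $C\in J$ let $S_C$ be the boundary of that (unique) body $B_C$, i.e. the convex surface parallel to $S_0$ at signed distance $C$ along the outward normals. Then $J$ is an interval, unbounded above, containing $[0,\infty)$; for each $C\in J$ the body $B_C$ has constant width $w_0+2C$; and, with $$\mathcal{I}(S_C)=\frac{\mathrm{Vol}(B_C)}{\mathrm{Vol}(\text{round ball of diameter } w_0+2C)},$$ the function $C\mapsto\mathcal{I}(S_C)$ is differentiable on $J$ (one-sidedly at the left endpoint of $J$, if that belongs to $J$) and satisfies $$\frac{d}{dC}\,\mathcal{I}(S_C)\ge 0\qquad\text{for all } C\in J .$$ In particular $\mathcal{I}(S_C)$ is nondecreasing in $C$ on $J$: shrinking the surface along its normals does not increase the ratio of volume to cubed width. -/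

import Mathlib

open Set Filter Topology MeasureTheory

noncomputable section

/-- Euclidean three-space. -/
abbrev E3 : Type := EuclideanSpace ℝ (Fin 3)

/-- The support function of a convex body: for a unit vector `u` it is the signed distance from the
origin to the supporting plane with outward normal `u`. -/
def supportFn (K : ConvexBody E3) (u : E3) : ℝ :=
  sSup ((fun x : E3 => inner ℝ x u) '' (K : Set E3))

/-- `K` has constant width `w > 0`: `r(u) + r(-u) = w` for every unit vector `u`, where `r` is the
support function of `K`. -/
def HasConstantWidth (K : ConvexBody E3) (w : ℝ) : Prop :=
  0 < w ∧ ∀ u : E3, ‖u‖ = 1 → supportFn K u + supportFn K (-u) = w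

/-- `S` is a `C²`-smooth embedded surface: near each of its points it is the zero set of a `C²`
function with nonvanishing differential. -/
def IsC2Surface (S : Set E3) : Prop :=
  ∀ p ∈ S, ∃ f : E3 → ℝ, ContDiffAt ℝ 2 f p ∧ fderiv ℝ f p ≠ 0 ∧ ∀ᶠ x in 𝓝 p, (x ∈ S ↔ f x = 0)

/-- The functional `𝓘` on a convex body `K` of constant width `w`: the volume of `K` divided by the
volume of the round ball of width (that is, diameter) `w`. -/
def volumeRatio (K : ConvexBody E3) (w : ℝ) : ℝ :=
  volume.real (K : Set E3) / volume.real (Metric.closedBall (0 : E3) (w / 2))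

/-- `K` is the convex body at signed distance `C` from `K₀` along the outward normals: its support
function is that of `K₀` plus `C`. -/
def IsParallelBody (K₀ : ConvexBody E3) (C : ℝ) (K : ConvexBody E3) : Prop :=
  ∀ u : E3, ‖u‖ = 1 → supportFn K u = supportFn K₀ u + C

/-- The admissible shifts `C`: the width `w₀ + 2C` is positive and there is a convex body whose
support function is that of `K₀` plus `C`. -/
def parallelRange (K₀ : ConvexBody E3) (w₀ : ℝ) : Set ℝ :=
  {C : ℝ | 0 < w₀ + 2 * C ∧ ∃ K : ConvexBody E3, IsParallelBody K₀ C K}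

end

/-! With `w = w₀ + 2C`, the volume of `B_C` is `π w³/6 - a w`, where `a ≥ 0` does not depend on `C`.
The ratio is therefore `1 - (6a/π)/w²`, which is nondecreasing.

For `C = t w₀ ≥ 0`, constant width gives `r(u) + C = (1+t) r(u) + t r(-u)`, so `B_C = (1+t)K₀ -
tK₀`. In dimension three `Vol(K - tK)` is a cubic in `t ≥ 0`. Since `K - tK = -t(K - t⁻¹K)`, that
cubic is palindromic, hence fixed by `Vol K` and `Vol(K - K)`; and `K₀ - K₀` is the ball of radius
`w₀`. Negative `C` follows by exchanging the two bodies. The sign of `a` is the isodiametric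
inequality, obtained by Steiner symmetrization.

The cubic comes from Gromov's map `z ↦ G(z) - t G(-z)`, with `G` the gradient of the log-Laplace
transform of `K`. It is injective onto `K - tK` up to a null set, and its Jacobian is a cubic in
`t`, nonnegative for `t ≥ 0`, so integrating the Jacobian gives the volume. -/

/-! ### Support functions, parallel bodies and constant width. -/

theorem isGreatest_supportFn (K : ConvexBody E3) (u : E3) :
    IsGreatest ((fun x : E3 => inner ℝ x u) '' (K : Set E3)) (supportFn K u) := by
  have hc : IsCompact ((fun x : E3 => inner ℝ x u) '' (K : Set E3)) :=
    K.isCompact.image (by fun_prop)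
  exact hc.isGreatest_sSup (K.nonempty.image _)

theorem inner_le_supportFn (K : ConvexBody E3) (u : E3) {x : E3} (hx : x ∈ K) :
    inner ℝ x u ≤ supportFn K u :=
  (isGreatest_supportFn K u).2 ⟨x, hx, rfl⟩

theorem supportFn_add (K L : ConvexBody E3) (u : E3) :
    supportFn (K + L) u = supportFn K u + supportFn L u := by
  refine (isGreatest_supportFn (K + L) u).unique ⟨?_, ?_⟩
  · obtain ⟨x, hx, hxu⟩ := (isGreatest_supportFn K u).1
    obtain ⟨y, hy, hyu⟩ := (isGreatest_supportFn L u).1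
    exact ⟨x + y, Set.add_mem_add hx hy, by
      simp only at hxu hyu ⊢; rw [inner_add_left, hxu, hyu]⟩
  · rintro _ ⟨_, ⟨x, hx, y, hy, rfl⟩, rfl⟩
    simp only [inner_add_left]
    exact add_le_add (inner_le_supportFn K u hx) (inner_le_supportFn L u hy)

theorem supportFn_smul (K : ConvexBody E3) {c : ℝ} (hc : 0 ≤ c) (u : E3) :
    supportFn (c • K) u = c * supportFn K u := by
  refine (isGreatest_supportFn (c • K) u).unique ⟨?_, ?_⟩
  · obtain ⟨x, hx, hxu⟩ := (isGreatest_supportFn K u).1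
    exact ⟨c • x, Set.smul_mem_smul_set hx, by
      simp only at hxu ⊢; rw [real_inner_smul_left, hxu]⟩
  · rintro _ ⟨_, ⟨x, hx, rfl⟩, rfl⟩
    simp only [real_inner_smul_left]
    exact mul_le_mul_of_nonneg_left (inner_le_supportFn K u hx) hc

theorem supportFn_neg_smul (K : ConvexBody E3) {c : ℝ} (hc : 0 ≤ c) (u : E3) :
    supportFn ((-c) • K) u = c * supportFn K (-u) := by
  refine (isGreatest_supportFn ((-c) • K) u).unique ⟨?_, ?_⟩
  · obtain ⟨x, hx, hxu⟩ := (isGreatest_supportFn K (-u)).1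
    refine ⟨(-c) • x, Set.smul_mem_smul_set hx, ?_⟩
    simp only [inner_neg_right] at hxu ⊢
    rw [real_inner_smul_left, ← hxu]; ring
  · rintro _ ⟨_, ⟨x, hx, rfl⟩, rfl⟩
    have := mul_le_mul_of_nonneg_left (inner_le_supportFn K (-u) hx) hc
    rw [inner_neg_right] at this
    simp only [real_inner_smul_left]
    linarith

/-- Hahn–Banach: a functional strictly separating `x` from `L` has a Riesz vector whose
normalization violates `h`. -/
theorem ConvexBody.mem_of_supportFn_le {K L : ConvexBody E3}
    (h : ∀ u : E3, ‖u‖ = 1 → supportFn K u ≤ supportFn L u) {x : E3} (hx : x ∈ K) : x ∈ L := by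
  by_contra hxL
  obtain ⟨f, b, hfb, hbx⟩ := geometric_hahn_banach_closed_point L.convex L.isClosed hxL
  set v : E3 := (InnerProductSpace.toDual ℝ E3).symm f with hv
  have hf : ∀ y, f y = inner ℝ y v := fun y => by
    rw [real_inner_comm, hv, InnerProductSpace.toDual_symm_apply]
  have hv0 : v ≠ 0 := by
    intro h0
    obtain ⟨y, hy⟩ := L.nonempty
    have := hfb y hy
    rw [hf, h0, inner_zero_right] at this hbx
    linarith
  have hpos : 0 < ‖v‖⁻¹ := inv_pos.2 (norm_pos_iff.2 hv0)
  have hu : ‖‖v‖⁻¹ • v‖ = 1 := by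
    rw [norm_smul, norm_inv, norm_norm, inv_mul_cancel₀ (norm_ne_zero_iff.2 hv0)]
  have h1 := inner_le_supportFn K (‖v‖⁻¹ • v) hx
  obtain ⟨y, hy, hyu⟩ := (isGreatest_supportFn L (‖v‖⁻¹ • v)).1
  have h2 := h _ hu
  rw [← hyu] at h2
  simp only [real_inner_smul_right] at h1 h2
  have h3 : inner ℝ x v ≤ inner ℝ y v := le_of_mul_le_mul_left (h1.trans h2) hpos
  have h4 := hfb y hy
  rw [hf] at h4 hbx
  linarith

theorem ConvexBody.eq_of_supportFn_eq {K L : ConvexBody E3}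
    (h : ∀ u : E3, ‖u‖ = 1 → supportFn K u = supportFn L u) : K = L :=
  ConvexBody.ext (Set.Subset.antisymm
    (fun _ hx => ConvexBody.mem_of_supportFn_le (fun u hu => (h u hu).le) hx)
    (fun _ hx => ConvexBody.mem_of_supportFn_le (fun u hu => (h u hu).ge) hx))

/-- The closed ball of radius `r` around the origin as a convex body. -/
def closedBallBody (r : ℝ) (hr : 0 ≤ r) : ConvexBody E3 where
  carrier := Metric.closedBall 0 r
  convex' := convex_closedBall 0 r
  isCompact' := isCompact_closedBall 0 r
  nonempty' := ⟨0, Metric.mem_closedBall_self hr⟩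

theorem coe_closedBallBody {r : ℝ} (hr : 0 ≤ r) :
    (closedBallBody r hr : Set E3) = Metric.closedBall 0 r := rfl

theorem supportFn_closedBallBody {r : ℝ} (hr : 0 ≤ r) {u : E3} (hu : ‖u‖ = 1) :
    supportFn (closedBallBody r hr) u = r := by
  refine (isGreatest_supportFn _ u).unique ⟨⟨r • u, ?_, ?_⟩, ?_⟩
  · change r • u ∈ Metric.closedBall 0 r
    simp [norm_smul, hu, abs_of_nonneg hr]
  · simp [real_inner_smul_left, hu]
  · rintro _ ⟨x, hx, rfl⟩
    have hx' : ‖x‖ ≤ r := by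
      change x ∈ Metric.closedBall 0 r at hx
      simpa using hx
    calc inner ℝ x u ≤ ‖x‖ * ‖u‖ := real_inner_le_norm x u
      _ ≤ r := by rw [hu, mul_one]; exact hx'

/-- A body of constant width `w` dilated by `1 + t` plus its reflection dilated by `t` is the
parallel body at distance `t * w`. -/
theorem HasConstantWidth.isParallelBody {K : ConvexBody E3} {w t : ℝ} (h : HasConstantWidth K w)
    (ht : 0 ≤ t) : IsParallelBody K (t * w) ((1 + t) • K + (-t) • K) := fun u hu => by
  rw [supportFn_add, supportFn_smul K (by linarith), supportFn_neg_smul K ht, ← h.2 u hu]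
  ring

/-- Supplies the value of the volume polynomial at `t = 1`. -/
theorem HasConstantWidth.sub_self {K : ConvexBody E3} {w : ℝ} (h : HasConstantWidth K w) :
    (1 : ℝ) • K + (-1 : ℝ) • K = closedBallBody w h.1.le :=
  ConvexBody.eq_of_supportFn_eq fun u hu => by
    rw [supportFn_add, supportFn_smul K zero_le_one, supportFn_neg_smul K zero_le_one,
      supportFn_closedBallBody h.1.le hu, ← h.2 u hu]
    ring

theorem IsParallelBody.hasConstantWidth {K L : ConvexBody E3} {w C : ℝ}
    (hw : HasConstantWidth K w) (hL : IsParallelBody K C L) (hC : 0 < w + 2 * C) :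
    HasConstantWidth L (w + 2 * C) :=
  ⟨hC, fun u hu => by
    rw [hL u hu, hL (-u) (by rwa [norm_neg]), ← hw.2 u hu]; ring⟩

theorem HasConstantWidth.dist_le {K : ConvexBody E3} {w : ℝ} (h : HasConstantWidth K w)
    {x y : E3} (hx : x ∈ K) (hy : y ∈ K) : dist x y ≤ w := by
  rcases eq_or_ne x y with rfl | hxy
  · simpa using h.1.le
  have hv0 : ‖x - y‖ ≠ 0 := norm_ne_zero_iff.2 (sub_ne_zero.2 hxy)
  have hu : ‖‖x - y‖⁻¹ • (x - y)‖ = 1 := by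
    rw [norm_smul, norm_inv, norm_norm, inv_mul_cancel₀ hv0]
  have h1 := inner_le_supportFn K (‖x - y‖⁻¹ • (x - y)) hx
  have h2 := inner_le_supportFn K (-(‖x - y‖⁻¹ • (x - y))) hy
  have h3 := h.2 _ hu
  have h4 : inner ℝ x (‖x - y‖⁻¹ • (x - y)) + inner ℝ y (-(‖x - y‖⁻¹ • (x - y))) = ‖x - y‖ := by
    rw [inner_neg_right, ← sub_eq_add_neg, ← inner_sub_left, real_inner_smul_right,
      real_inner_self_eq_norm_sq]
    field_simp
  rw [dist_eq_norm]
  linarith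

/-- Otherwise the body lies in a hyperplane and has width zero along its normal. -/
theorem HasConstantWidth.interior_nonempty {K : ConvexBody E3} {w : ℝ}
    (h : HasConstantWidth K w) : (interior (K : Set E3)).Nonempty := by
  rw [K.convex.interior_nonempty_iff_affineSpan_eq_top]
  by_contra hne
  obtain ⟨p, hp⟩ := K.nonempty
  have hdir : (affineSpan ℝ (K : Set E3)).direction ≠ ⊤ := fun htop =>
    hne ((AffineSubspace.direction_eq_top_iff_of_nonempty
      ⟨p, subset_affineSpan ℝ _ hp⟩).1 htop)
  obtain ⟨v, hv, hv0⟩ := Submodule.exists_mem_ne_zero_of_ne_bot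
    (mt (Submodule.orthogonal_eq_bot_iff).1 hdir)
  have hn : ‖v‖ ≠ 0 := norm_ne_zero_iff.2 hv0
  have hu : ‖‖v‖⁻¹ • v‖ = 1 := by
    rw [norm_smul, norm_inv, norm_norm, inv_mul_cancel₀ hn]
  obtain ⟨x, hx, hxu⟩ := (isGreatest_supportFn K (‖v‖⁻¹ • v)).1
  obtain ⟨y, hy, hyu⟩ := (isGreatest_supportFn K (-(‖v‖⁻¹ • v))).1
  have h3 := h.2 _ hu
  have h4 : inner ℝ (x - y) v = 0 :=
    (Submodule.mem_orthogonal _ v).1 hv _ (AffineSubspace.vsub_mem_direction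
      (subset_affineSpan ℝ _ hx) (subset_affineSpan ℝ _ hy))
  simp only [inner_neg_right, real_inner_smul_right] at hxu hyu
  rw [← hxu, ← hyu, ← sub_eq_add_neg, ← mul_sub, ← inner_sub_left, h4, mul_zero] at h3
  exact absurd h.1 (by rw [h3]; exact lt_irrefl _)

/-! ### Steiner symmetrization and the isodiametric inequality. -/

section Steiner

variable {ι : Type*} [DecidableEq ι]

/-- The Steiner symmetral of `A` in the `i`-th coordinate direction, with open sections. -/
def steinerSymm (i : ι) (A : Set (ι → ℝ)) : Set (ι → ℝ) :=
  {x | ENNReal.ofReal (2 * |x i|) < volume {t : ℝ | Function.update x i t ∈ A}}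

theorem lmarginal_singleton_indicator [Fintype ι] (i : ι) {A : Set (ι → ℝ)} (hA : MeasurableSet A)
    (x : ι → ℝ) :
    lmarginal (fun _ => volume) {i} (A.indicator 1) x =
      volume {t : ℝ | Function.update x i t ∈ A} := by
  have hm : MeasurableSet {t : ℝ | Function.update x i t ∈ A} := measurable_update x hA
  rw [lmarginal_singleton, ← lintegral_indicator_one hm]
  rfl

theorem measurable_volume_section [Fintype ι] (i : ι) {A : Set (ι → ℝ)} (hA : MeasurableSet A) :
    Measurable fun x : ι → ℝ => volume {t : ℝ | Function.update x i t ∈ A} := by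
  simp_rw [← lmarginal_singleton_indicator i hA]
  exact Measurable.lmarginal _ (measurable_one.indicator hA)

theorem measurableSet_steinerSymm [Fintype ι] (i : ι) {A : Set (ι → ℝ)} (hA : MeasurableSet A) :
    MeasurableSet (steinerSymm i A) :=
  measurableSet_lt (by fun_prop) (measurable_volume_section i hA)

theorem volume_setOf_ofReal_two_mul_abs_lt (v : ENNReal) :
    volume {t : ℝ | ENNReal.ofReal (2 * |t|) < v} = v := by
  induction v with
  | top =>
    rw [show {t : ℝ | ENNReal.ofReal (2 * |t|) < ⊤} = univ from
      eq_univ_of_forall fun t => ENNReal.ofReal_lt_top, Real.volume_univ]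
  | coe v =>
    have : {t : ℝ | ENNReal.ofReal (2 * |t|) < v} = Ioo (-(v / 2 : ℝ)) (v / 2) := by
      ext t
      rw [mem_ofPred_eq, mem_Ioo, ← abs_lt, ← ENNReal.ofReal_coe_nnreal,
        ENNReal.ofReal_lt_ofReal_iff_of_nonneg (by positivity), lt_div_iff₀ two_pos, mul_comm]
    rw [this, Real.volume_Ioo]
    simp

theorem volume_steinerSymm [Fintype ι] (i : ι) {A : Set (ι → ℝ)} (hA : MeasurableSet A) :
    volume (steinerSymm i A) = volume A := by
  rw [← lintegral_indicator_one hA,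
    ← lintegral_indicator_one (measurableSet_steinerSymm i hA)]
  refine lintegral_eq_of_lmarginal_eq {i}
    (measurable_one.indicator (measurableSet_steinerSymm i hA)) (measurable_one.indicator hA) ?_
  ext x
  rw [lmarginal_singleton_indicator i (measurableSet_steinerSymm i hA),
    lmarginal_singleton_indicator i hA]
  simp only [steinerSymm, mem_ofPred_eq, Function.update_self, Function.update_idem]
  exact volume_setOf_ofReal_two_mul_abs_lt _

/-- If all distances were below `a + b`, then `sup X - inf Y` and `sup Y - inf X` would be at most
`a + b`. Their sum is the sum of the lengths of the convex hulls, which exceeds `2a + 2b`. -/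
theorem Real.exists_add_le_abs_sub {X Y : Set ℝ} {a b : ℝ} (ha : 0 ≤ a) (hb : 0 ≤ b)
    (hX : ENNReal.ofReal (2 * a) < volume X) (hY : ENNReal.ofReal (2 * b) < volume Y) :
    ∃ s ∈ X, ∃ t ∈ Y, a + b ≤ |s - t| := by
  by_contra! h
  obtain ⟨s₀, hs₀⟩ := nonempty_of_measure_ne_zero (bot_lt_of_lt hX).ne'
  obtain ⟨t₀, ht₀⟩ := nonempty_of_measure_ne_zero (bot_lt_of_lt hY).ne'
  have h1 : ∀ s ∈ X, ∀ t ∈ Y, s - t ≤ a + b := fun s hs t ht =>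
    (le_abs_self _).trans (h s hs t ht).le
  have h2 : ∀ s ∈ X, ∀ t ∈ Y, t - s ≤ a + b := fun s hs t ht =>
    (le_abs_self _).trans ((abs_sub_comm t s).trans_le (h s hs t ht).le)
  have hXa : BddAbove X := ⟨t₀ + (a + b), fun s hs => by linarith [h1 s hs t₀ ht₀]⟩
  have hXb : BddBelow X := ⟨t₀ - (a + b), fun s hs => by linarith [h2 s hs t₀ ht₀]⟩
  have hYa : BddAbove Y := ⟨s₀ + (a + b), fun t ht => by linarith [h2 s₀ hs₀ t ht]⟩
  have hYb : BddBelow Y := ⟨s₀ - (a + b), fun t ht => by linarith [h1 s₀ hs₀ t ht]⟩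
  have hXY : sSup X ≤ sInf Y + (a + b) := csSup_le ⟨s₀, hs₀⟩ fun s hs => by
    linarith [le_csInf ⟨t₀, ht₀⟩ fun t ht => show s - (a + b) ≤ t by linarith [h1 s hs t ht]]
  have hYX : sSup Y ≤ sInf X + (a + b) := csSup_le ⟨t₀, ht₀⟩ fun t ht => by
    linarith [le_csInf ⟨s₀, hs₀⟩ fun s hs => show t - (a + b) ≤ s by linarith [h2 s hs t ht]]
  have key : ∀ {Z : Set ℝ} {c : ℝ}, 0 ≤ c → BddAbove Z → BddBelow Z →
      ENNReal.ofReal (2 * c) < volume Z → 2 * c < sSup Z - sInf Z := by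
    intro Z c hc hZa hZb hZ
    have hsub : Z ⊆ Icc (sInf Z) (sSup Z) := fun z hz => ⟨csInf_le hZb hz, le_csSup hZa hz⟩
    have := hZ.trans_le (measure_mono hsub)
    rw [Real.volume_Icc] at this
    exact (ENNReal.ofReal_lt_ofReal_iff_of_nonneg (by positivity)).1 this
  linarith [key ha hXa hXb hX, key hb hYa hYb hY]

theorem sum_sq_sub_le_of_mem_steinerSymm [Fintype ι] (i : ι) {A : Set (ι → ℝ)} {D : ℝ}
    (hA : ∀ x ∈ A, ∀ y ∈ A, ∑ j, (x j - y j) ^ 2 ≤ D) {x y : ι → ℝ}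
    (hx : x ∈ steinerSymm i A) (hy : y ∈ steinerSymm i A) : ∑ j, (x j - y j) ^ 2 ≤ D := by
  obtain ⟨s, hs, t, ht, hst⟩ := Real.exists_add_le_abs_sub (abs_nonneg _) (abs_nonneg _) hx hy
  refine le_trans (Finset.sum_le_sum fun j _ => ?_) (hA _ hs _ ht)
  rcases eq_or_ne j i with rfl | hj
  · rw [Function.update_self, Function.update_self]
    exact sq_le_sq.2 ((abs_sub _ _).trans hst)
  · rw [Function.update_of_ne hj, Function.update_of_ne hj]

/-- Symmetrizing in direction `i` preserves an earlier symmetry in direction `j`, because points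
reflected in `j` have sections of the same length. -/
theorem exists_symmetrization [Fintype ι] {A : Set (ι → ℝ)} (hA : MeasurableSet A) {D : ℝ}
    (hD : ∀ x ∈ A, ∀ y ∈ A, ∑ j, (x j - y j) ^ 2 ≤ D) (s : Finset ι) :
    ∃ B : Set (ι → ℝ), MeasurableSet B ∧ volume B = volume A ∧
      (∀ x ∈ B, ∀ y ∈ B, ∑ j, (x j - y j) ^ 2 ≤ D) ∧
      ∀ j ∈ s, ∀ x ∈ B, Function.update x j (-x j) ∈ B := by
  induction s using Finset.induction_on with
  | empty => exact ⟨A, hA, rfl, hD, by simp⟩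
  | insert i s his ih =>
    obtain ⟨B, hB, hBA, hBD, hBs⟩ := ih
    refine ⟨steinerSymm i B, measurableSet_steinerSymm i hB,
      (volume_steinerSymm i hB).trans hBA,
      fun x hx y hy => sum_sq_sub_le_of_mem_steinerSymm i hBD hx hy, fun j hj x hx => ?_⟩
    rcases eq_or_ne j i with rfl | hji
    · simpa [steinerSymm] using hx
    · have hjs : j ∈ s := (Finset.mem_insert.1 hj).resolve_left hji
      refine lt_of_lt_of_le ?_ (measure_mono (s := {t | Function.update x i t ∈ B}) ?_)
      · rw [Function.update_of_ne hji.symm]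
        exact hx
      · intro t ht
        have := hBs j hjs _ ht
        rw [Function.update_of_ne hji] at this
        rwa [mem_ofPred_eq, Function.update_comm hji]

end Steiner

/-- The isodiametric inequality in Euclidean space. -/
theorem volume_le_volume_closedBall_of_dist_le {ι : Type*} [Fintype ι]
    {A : Set (EuclideanSpace ℝ ι)} (hA : MeasurableSet A) {d : ℝ} (hd : 0 ≤ d)
    (h : ∀ x ∈ A, ∀ y ∈ A, dist x y ≤ d) :
    volume A ≤ volume (Metric.closedBall (0 : EuclideanSpace ℝ ι) (d / 2)) := by
  classical
  have hmp := EuclideanSpace.volume_preserving_symm_measurableEquiv_toLp ι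
  have hmp' := hmp.symm
  set e := (MeasurableEquiv.toLp 2 (ι → ℝ)).symm with he
  obtain ⟨B, hB, hBA, hBD, hBs⟩ := exists_symmetrization (A := e.symm ⁻¹' A) (e.symm.measurable hA)
    (D := d ^ 2) (fun x hx y hy => by
      have := h _ hx _ hy
      rw [EuclideanSpace.dist_eq, Real.sqrt_le_left hd] at this
      simpa [he, Real.dist_eq, sq_abs] using this) Finset.univ
  rw [hmp'.measure_preimage hA.nullMeasurableSet] at hBA
  rw [← hBA, ← hmp.measure_preimage hB.nullMeasurableSet]
  refine measure_mono fun x hx => ?_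
  have hx' : (fun j => x j) ∈ B := hx
  -- Flipping the coordinates one at a time reaches `-x`, so `2‖x‖ ≤ d`.
  have hneg : ∀ s : Finset ι, s.piecewise (fun j => -x j) (fun j => x j) ∈ B := by
    intro s
    induction s using Finset.induction_on with
    | empty => simpa using hx'
    | insert i s his ih =>
      have := hBs i (Finset.mem_univ i) _ ih
      rwa [Finset.piecewise_insert, ← Finset.piecewise_eq_of_notMem s (fun j => -x j)
        (fun j => x j) his]
  have h2 := hBD _ hx' _ (hneg Finset.univ)
  rw [mem_closedBall_zero_iff, EuclideanSpace.norm_eq, Real.sqrt_le_left (by positivity)]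
  simp only [Finset.piecewise_univ, sub_neg_eq_add, ← two_mul, mul_pow, ← Finset.mul_sum] at h2
  simp only [Real.norm_eq_abs, sq_abs]
  linarith

/-! ### The gradient of the log-Laplace transform of a convex body. -/

section LaplaceMap

open scoped RealInnerProductSpace

variable {E : Type*} [NormedAddCommGroup E] [InnerProductSpace ℝ E] [MeasurableSpace E]
  {F : Type*} [NormedAddCommGroup F] [NormedSpace ℝ F]

/-- The integral of `f` over `K` with exponential weight `p ↦ exp ⟪z, p⟫`. -/
noncomputable def expMoment (μ : Measure E) (K : Set E) (f : E → F) (z : E) : F :=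
  ∫ p in K, Real.exp ⟪z, p⟫ • f p ∂μ

/-- The centroid of `K` with exponential weight `p ↦ exp ⟪z, p⟫`; it is the gradient of the
logarithm of the Laplace transform of `K`. -/
noncomputable def expCentroid (μ : Measure E) (K : Set E) (z : E) : E :=
  (expMoment μ K (fun _ => (1 : ℝ)) z)⁻¹ • expMoment μ K (fun p => p) z

variable [BorelSpace E] {μ : Measure E} [μ.IsAddHaarMeasure] {K : Set E}

theorem integrableOn_exp_inner_smul (hK : IsCompact K) {f : E → F} (hf : Continuous f) (z : E) :
    IntegrableOn (fun p => Real.exp ⟪z, p⟫ • f p) K μ :=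
  (by fun_prop : Continuous fun p => Real.exp ⟪z, p⟫ • f p).continuousOn.integrableOn_compact hK

theorem hasFDerivAt_expMoment (hK : IsCompact K) {f : E → F} (hf : Continuous f) (z : E) :
    HasFDerivAt (expMoment μ K f)
      (expMoment μ K (fun p => (innerSL ℝ p).smulRight (f p)) z) z := by
  have hsm : Continuous fun p : E => (innerSL ℝ p).smulRight (f p) :=
    (ContinuousLinearMap.smulRightL ℝ E F).continuous₂.comp
      ((innerSL ℝ).continuous.prodMk hf)
  refine hasFDerivAt_integral_of_dominated_of_fderiv_le
    (F' := fun z p => Real.exp ⟪z, p⟫ • (innerSL ℝ p).smulRight (f p))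
    (bound := fun p => Real.exp ((‖z‖ + 1) * ‖p‖) * (‖p‖ * ‖f p‖))
    (Metric.ball_mem_nhds z one_pos)
    (Eventually.of_forall fun x => (integrableOn_exp_inner_smul hK hf x).aestronglyMeasurable)
    (integrableOn_exp_inner_smul hK hf z)
    (integrableOn_exp_inner_smul hK hsm z).aestronglyMeasurable
    (Eventually.of_forall fun p x hx => ?_) ?_ (Eventually.of_forall fun p x _ => ?_)
  · rw [norm_smul, ContinuousLinearMap.norm_smulRight_apply, innerSL_apply_norm, Real.norm_eq_abs,
      Real.abs_exp]
    gcongr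
    have hx' : ‖x‖ ≤ ‖z‖ + 1 := by
      have := norm_le_norm_add_norm_sub' x z
      rw [mem_ball_iff_norm] at hx
      linarith
    exact (real_inner_le_norm x p).trans (by gcongr)
  · exact (by fun_prop : Continuous fun p => Real.exp ((‖z‖ + 1) * ‖p‖) *
      (‖p‖ * ‖f p‖)).continuousOn.integrableOn_compact hK
  · have h1 : HasFDerivAt (fun y : E => ⟪y, p⟫) (innerSL ℝ p) x := by
      have := (innerSL ℝ p).hasFDerivAt (x := x)
      simpa [real_inner_comm] using this
    convert h1.exp.smul_const (f p) using 1
    ext y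
    simp [mul_smul]

theorem expMoment_one_pos (hK : IsCompact K) (hKi : (interior K).Nonempty) (z : E) :
    0 < expMoment μ K (fun _ => (1 : ℝ)) z := by
  have : NeZero (μ.restrict K) := ⟨by
    rw [Ne, Measure.restrict_eq_zero]
    exact ((isOpen_interior.measure_pos μ hKi).trans_le (measure_mono interior_subset)).ne'⟩
  have hi := integrableOn_exp_inner_smul (μ := μ) hK (f := fun _ => (1 : ℝ)) continuous_const z
  simp only [smul_eq_mul, mul_one] at hi
  simpa [expMoment] using integral_exp_pos hi

theorem differentiable_expCentroid (hK : IsCompact K) (hKi : (interior K).Nonempty) :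
    Differentiable ℝ (expCentroid μ K) := fun z =>
  ((hasFDerivAt_expMoment hK continuous_const z).differentiableAt.inv
    (expMoment_one_pos hK hKi z).ne').smul
    (hasFDerivAt_expMoment hK continuous_id z).differentiableAt

variable [FiniteDimensional ℝ E]

theorem inner_expMoment (hK : IsCompact K) (z v : E) :
    ⟪expMoment μ K (fun p => p) z, v⟫ = expMoment μ K (fun p => ⟪p, v⟫) z := by
  rw [real_inner_comm, expMoment,
    ← integral_inner (integrableOn_exp_inner_smul (f := fun p => p) hK continuous_id z), expMoment]
  simp only [real_inner_smul_right, smul_eq_mul, real_inner_comm]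

theorem hasFDerivAt_log_expMoment (hK : IsCompact K) (hKi : (interior K).Nonempty) (z : E) :
    HasFDerivAt (fun z => Real.log (expMoment μ K (fun _ => (1 : ℝ)) z))
      (innerSL ℝ (expCentroid μ K z)) z := by
  have h := (hasFDerivAt_expMoment (μ := μ) hK (f := fun _ => (1 : ℝ)) continuous_const z).log
    (expMoment_one_pos hK hKi z).ne'
  convert h using 1
  rw [expCentroid, map_smul]
  congr 1
  ext v
  rw [innerSL_apply_apply, inner_expMoment hK, expMoment, expMoment,
    ContinuousLinearMap.integral_apply]
  · simp
  · refine integrableOn_exp_inner_smul hK ?_ z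
    exact (ContinuousLinearMap.smulRightL ℝ E ℝ).continuous₂.comp
      ((innerSL ℝ).continuous.prodMk continuous_const)

/-- It is the barycenter of an exponentially tilted probability measure carried by the closed convex
set `K`. -/
theorem expCentroid_mem (hK : IsCompact K) (hKc : Convex ℝ K) (hKi : (interior K).Nonempty)
    (z : E) : expCentroid μ K z ∈ K := by
  have : NeZero (μ.restrict K) := ⟨by
    rw [Ne, Measure.restrict_eq_zero]
    exact ((isOpen_interior.measure_pos μ hKi).trans_le (measure_mono interior_subset)).ne'⟩
  have hi := integrableOn_exp_inner_smul (μ := μ) hK (f := fun _ => (1 : ℝ)) continuous_const z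
  simp only [smul_eq_mul, mul_one] at hi
  have := isProbabilityMeasure_tilted hi
  have hmem := hKc.integral_mem (μ := (μ.restrict K).tilted fun p => ⟪z, p⟫) (f := fun p => p)
    hK.isClosed ((tilted_absolutelyContinuous _ _).ae_le (ae_restrict_mem hK.measurableSet))
    ((integrable_tilted_iff (f := fun p => ⟪z, p⟫) hi _).2 (integrableOn_exp_inner_smul hK continuous_id z))
  rw [integral_tilted] at hmem
  convert hmem using 1
  simp only [expCentroid, expMoment, smul_eq_mul, mul_one, div_eq_inv_mul, mul_smul]
  rw [integral_smul]

/-- Strict monotonicity of the gradient, by Chebyshev's trick: with `m` the `z'`-mean of `⟪p, v⟫`,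
integrate `(exp ⟪p, v⟫ - exp m) (⟪p, v⟫ - m) ≥ 0` against the `z'`-weight. The `exp m` term
vanishes, and the other is the `z`-integral of `⟪p, v⟫ - m`. -/
theorem inner_expCentroid_sub_pos (hK : IsCompact K) (hKi : (interior K).Nonempty) {z z' : E}
    (hz : z ≠ z') : 0 < ⟪expCentroid μ K z - expCentroid μ K z', z - z'⟫ := by
  set v := z - z' with hv
  set m := ⟪expCentroid μ K z', v⟫ with hm
  have hZ := fun y => expMoment_one_pos (μ := μ) hK hKi y
  have hlin : ∀ y, ∫ p in K, Real.exp ⟪y, p⟫ * (⟪p, v⟫ - m) ∂μ =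
      expMoment μ K (fun _ => (1 : ℝ)) y * (⟪expCentroid μ K y, v⟫ - m) := by
    intro y
    have h1 := integrableOn_exp_inner_smul (μ := μ) hK (f := fun p => ⟪p, v⟫) (by fun_prop) y
    have h2 := integrableOn_exp_inner_smul (μ := μ) hK (f := fun _ => (1 : ℝ)) continuous_const y
    simp only [smul_eq_mul] at h1 h2
    simp only [mul_sub]
    rw [integral_sub h1 (by simpa using h2.mul_const m), integral_mul_const, expCentroid,
      real_inner_smul_left, inner_expMoment hK, ← mul_assoc, mul_inv_cancel₀ (hZ y).ne', one_mul]
    simp [expMoment]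
  have h0 := hlin z'
  rw [← hm, sub_self, mul_zero] at h0
  have hz1 := hlin z
  have hpos : 0 < ∫ p in K, Real.exp ⟪z', p⟫ *
      ((Real.exp ⟪p, v⟫ - Real.exp m) * (⟪p, v⟫ - m)) ∂μ := by
    have hnn : ∀ p, 0 ≤ Real.exp ⟪z', p⟫ *
        ((Real.exp ⟪p, v⟫ - Real.exp m) * (⟪p, v⟫ - m)) := by
      intro p
      refine mul_nonneg (Real.exp_pos _).le ?_
      rcases le_total ⟪p, v⟫ m with h | h
      · exact mul_nonneg_of_nonpos_of_nonpos (sub_nonpos.2 (Real.exp_le_exp.2 h)) (sub_nonpos.2 h)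
      · exact mul_nonneg (sub_nonneg.2 (Real.exp_le_exp.2 h)) (sub_nonneg.2 h)
    rw [setIntegral_pos_iff_support_of_nonneg_ae (Eventually.of_forall hnn)
      ((by fun_prop : Continuous _).continuousOn.integrableOn_compact hK)]
    -- The integrand is nonzero off a hyperplane, which cannot fill the interior.
    have hU : IsOpen (interior K ∩ {p | ⟪p, v⟫ ≠ m}) :=
      isOpen_interior.inter (isOpen_ne_fun (by fun_prop) continuous_const)
    refine (hU.measure_pos μ ?_).trans_le (measure_mono ?_)
    · obtain ⟨q, hq⟩ := hKi
      by_cases hqm : ⟪q, v⟫ = m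
      · have ht : Tendsto (fun ε : ℝ => q + ε • v) (𝓝[≠] 0) (𝓝 q) := by
          have : Continuous fun ε : ℝ => q + ε • v := by fun_prop
          simpa using (this.tendsto 0).mono_left nhdsWithin_le_nhds
        obtain ⟨ε, hε, hε0⟩ := ((ht.eventually (isOpen_interior.mem_nhds hq)).and
          self_mem_nhdsWithin).exists
        refine ⟨q + ε • v, hε, ?_⟩
        have hvv : ⟪v, v⟫ ≠ 0 := inner_self_ne_zero.2 (sub_ne_zero.2 hz)
        simp only [mem_ofPred_eq, inner_add_left, real_inner_smul_left, hqm]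
        simpa using ⟨hε0, sub_ne_zero.2 hz⟩
      · exact ⟨q, hq, hqm⟩
    · rintro p ⟨hp, hpm⟩
      refine ⟨?_, interior_subset hp⟩
      rw [Function.mem_support]
      exact mul_ne_zero (Real.exp_pos _).ne' (mul_ne_zero
        (sub_ne_zero.2 fun h => hpm (Real.exp_injective h)) (sub_ne_zero.2 hpm))
  have hsplit : ∀ p, Real.exp ⟪z', p⟫ * ((Real.exp ⟪p, v⟫ - Real.exp m) * (⟪p, v⟫ - m)) =
      Real.exp ⟪z, p⟫ * (⟪p, v⟫ - m) - Real.exp m * (Real.exp ⟪z', p⟫ * (⟪p, v⟫ - m)) := by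
    intro p
    have : Real.exp ⟪z, p⟫ = Real.exp ⟪z', p⟫ * Real.exp ⟪p, v⟫ := by
      rw [← Real.exp_add, real_inner_comm v p, ← inner_add_left, hv, add_sub_cancel]
    rw [this]; ring
  simp only [hsplit] at hpos
  rw [integral_sub ((by fun_prop : Continuous _).continuousOn.integrableOn_compact hK)
    ((by fun_prop : Continuous _).continuousOn.integrableOn_compact hK), integral_const_mul, h0,
    mul_zero, sub_zero, hz1] at hpos
  rw [inner_sub_left]
  exact (pos_iff_pos_of_mul_pos hpos).1 (hZ z)

/-- The copy of `K` shrunk towards `q` by a factor `l` stays in `K`, its volume does not depend on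
`z` or `q`, and on it `⟪z, p⟫ ≥ ⟪z, q⟫ - ε‖z‖`. This is the source of coercivity below. -/
theorem exists_le_log_expMoment (hK : IsCompact K) (hKc : Convex ℝ K)
    (hKi : (interior K).Nonempty) {ε : ℝ} (hε : 0 < ε) :
    ∃ c : ℝ, ∀ z, ∀ q ∈ K,
      ⟪z, q⟫ ≤ Real.log (expMoment μ K (fun _ => (1 : ℝ)) z) + ε * ‖z‖ + c := by
  set D := Metric.diam K with hD
  have hD0 : 0 ≤ D := Metric.diam_nonneg
  set l : ℝ := min 1 (ε / (D + 1)) with hl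
  have hl0 : 0 < l := lt_min one_pos (by positivity)
  have hlD : l * D ≤ ε := calc
    l * D ≤ ε / (D + 1) * (D + 1) :=
      mul_le_mul (min_le_right _ _) (by linarith) hD0 (by positivity)
    _ = ε := by field_simp
  have hKpos : 0 < μ.real K := ENNReal.toReal_pos
    ((isOpen_interior.measure_pos μ hKi).trans_le (measure_mono interior_subset)).ne'
    hK.measure_ne_top
  set V : ℝ := l ^ Module.finrank ℝ E * μ.real K with hV
  have hV0 : 0 < V := by positivity
  refine ⟨-Real.log V, fun z q hq => ?_⟩
  set T := AffineMap.homothety q l '' K with hT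
  have hTK : T ⊆ K := by
    rintro _ ⟨p, hp, rfl⟩
    rw [AffineMap.homothety_eq_lineMap]
    exact hKc.lineMap_mem hq hp ⟨hl0.le, min_le_left _ _⟩
  have hTm : MeasurableSet T :=
    (hK.image (AffineMap.continuous_of_finiteDimensional _)).measurableSet
  have hTV : μ.real T = V := by
    rw [measureReal_def, hT, Measure.addHaar_image_homothety, ENNReal.toReal_mul, hV,
      ENNReal.toReal_ofReal (abs_nonneg _), abs_of_nonneg (by positivity), measureReal_def]
  have hi : IntegrableOn (fun p => Real.exp ⟪z, p⟫) K μ :=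
    (by fun_prop : Continuous _).continuousOn.integrableOn_compact hK
  have hle : Real.exp (⟪z, q⟫ - ε * ‖z‖) * V ≤ expMoment μ K (fun _ => (1 : ℝ)) z := by
    have h1 : ∫ p in T, Real.exp (⟪z, q⟫ - ε * ‖z‖) ∂μ ≤ ∫ p in T, Real.exp ⟪z, p⟫ ∂μ := by
      refine setIntegral_mono_on (integrableOn_const
        ((measure_mono hTK).trans_lt hK.measure_lt_top).ne) (hi.mono_set hTK) hTm ?_
      rintro _ ⟨p, hp, rfl⟩
      rw [Real.exp_le_exp, AffineMap.homothety_apply, vsub_eq_sub, vadd_eq_add, inner_add_right,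
        real_inner_smul_right]
      have h2 : |⟪z, p - q⟫| ≤ ‖z‖ * D := (abs_real_inner_le_norm z _).trans
        (mul_le_mul_of_nonneg_left (by
          rw [← dist_eq_norm]; exact Metric.dist_le_diam_of_mem hK.isBounded hp hq)
          (norm_nonneg _))
      have h3 := mul_le_mul_of_nonneg_left (neg_le_of_abs_le h2) hl0.le
      have h4 := mul_le_mul_of_nonneg_right hlD (norm_nonneg z)
      linarith
    have h2 : ∫ p in T, Real.exp ⟪z, p⟫ ∂μ ≤ ∫ p in K, Real.exp ⟪z, p⟫ ∂μ :=
      setIntegral_mono_set hi (Eventually.of_forall fun p => (Real.exp_pos _).le)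
        hTK.eventuallyLE
    rw [setIntegral_const, hTV, smul_eq_mul, mul_comm] at h1
    simpa [expMoment] using h1.trans h2
  have := Real.log_le_log (by positivity) hle
  rw [Real.log_mul (Real.exp_pos _).ne' hV0.ne', Real.log_exp] at this
  linarith

end LaplaceMap

/-! ### Determinants of monotone linear maps and of pencils. -/

section Determinant

open scoped RealInnerProductSpace

/-- On the segment from `f` to the identity every map except possibly `f` is positive definite,
hence invertible; the determinant ends at `1` and cannot change sign. No self-adjointness is needed.
-/
theorem ContinuousLinearMap.det_nonneg_of_inner_nonneg {E : Type*} [NormedAddCommGroup E]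
    [InnerProductSpace ℝ E] [FiniteDimensional ℝ E] (f : E →L[ℝ] E)
    (h : ∀ v, 0 ≤ ⟪f v, v⟫) : 0 ≤ f.det := by
  by_contra! hneg
  set g : ℝ → ℝ := fun s => (f + s • (ContinuousLinearMap.id ℝ E - f)).det with hg
  have hgc : Continuous g := by
    have : Continuous fun s : ℝ => f + s • (ContinuousLinearMap.id ℝ E - f) := by fun_prop
    exact ContinuousLinearMap.continuous_det.comp this
  have h0 : g 0 < 0 := by simpa [hg] using hneg
  have h1 : g 1 = 1 := by simp [hg, ContinuousLinearMap.det]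
  obtain ⟨s, hs, hs0⟩ := intermediate_value_Icc zero_le_one hgc.continuousOn
    (show (0 : ℝ) ∈ Icc (g 0) (g 1) from ⟨h0.le, by rw [h1]; exact zero_le_one⟩)
  have hspos : 0 < s := hs.1.lt_of_ne (by rintro rfl; linarith)
  refine absurd hs0 ?_
  have hinj : Function.Injective (f + s • (ContinuousLinearMap.id ℝ E - f)) := by
    refine (injective_iff_map_eq_zero _).2 fun v hv => ?_
    have h2 : ⟪(f + s • (ContinuousLinearMap.id ℝ E - f)) v, v⟫ = 0 := by
      rw [hv, inner_zero_left]
    simp only [add_apply, smul_apply,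
      sub_apply, ContinuousLinearMap.id_apply, inner_add_left,
      real_inner_smul_left, inner_sub_left] at h2
    have h3 := mul_nonneg (sub_nonneg.2 hs.2) (h v)
    have h4 : s * ⟪v, v⟫ ≤ 0 := by linarith
    have h5 : ⟪v, v⟫ ≤ 0 := nonpos_of_mul_nonpos_right h4 hspos
    exact inner_self_eq_zero.1 (h5.antisymm real_inner_self_nonneg)
  exact (LinearEquiv.ofInjectiveEndo _ hinj).isUnit_det'.ne_zero

/-- Lagrange interpolation at `0, 1, 2, 3` of the cubic polynomial `t ↦ det (f + t g)`. -/
theorem ContinuousLinearMap.det_add_smul_eq {E : Type*} [NormedAddCommGroup E]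
    [NormedSpace ℝ E] (hE : Module.finrank ℝ E = 3) (f g : E →L[ℝ] E) (t : ℝ) :
    (f + t • g).det =
      -((t - 1) * (t - 2) * (t - 3) / 6) * (f + (0 : ℝ) • g).det
        + t * (t - 2) * (t - 3) / 2 * (f + (1 : ℝ) • g).det
        - t * (t - 1) * (t - 3) / 2 * (f + (2 : ℝ) • g).det
        + t * (t - 1) * (t - 2) / 6 * (f + (3 : ℝ) • g).det := by
  have : FiniteDimensional ℝ E := Module.finite_of_finrank_pos (by omega)
  have b : Module.Basis (Fin 3) ℝ E := Module.finBasisOfFinrankEq ℝ E hE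
  have key : ∀ s : ℝ, (f + s • g).det =
      (LinearMap.toMatrix b b f + s • LinearMap.toMatrix b b g).det := by
    intro s
    rw [ContinuousLinearMap.det, ← LinearMap.det_toMatrix b, ← map_smul, ← map_add]
    rfl
  simp only [key, Matrix.det_fin_three, Matrix.add_apply, Matrix.smul_apply, smul_eq_mul]
  ring

end Determinant

/-! ### Volume of `K - tK` as a palindromic cubic in `t`. -/

section VolumePolynomial

open scoped RealInnerProductSpace Pointwise

variable {E : Type*} [NormedAddCommGroup E] [InnerProductSpace ℝ E] [MeasurableSpace E]
  [BorelSpace E] {μ : Measure E} [μ.IsAddHaarMeasure] {K : Set E}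

/-- Gromov's map onto the interior of `K - t K`. -/
noncomputable def differenceMap (μ : Measure E) (K : Set E) (t : ℝ) (z : E) : E :=
  expCentroid μ K z - t • expCentroid μ K (-z)

theorem hasFDerivAt_differenceMap (hK : IsCompact K) (hKi : (interior K).Nonempty) (t : ℝ)
    (z : E) : HasFDerivAt (differenceMap μ K t)
      (fderiv ℝ (expCentroid μ K) z + t • fderiv ℝ (expCentroid μ K) (-z)) z := by
  have hd := differentiable_expCentroid (μ := μ) hK hKi
  have h1 : HasFDerivAt (fun z => expCentroid μ K (-z)) (-fderiv ℝ (expCentroid μ K) (-z)) z := by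
    have := (hd (-z)).hasFDerivAt.comp z (hasFDerivAt_id z).neg
    simpa [Function.comp_def] using this
  refine ((hd z).hasFDerivAt.sub (h1.const_smul t)).congr_fderiv ?_
  rw [smul_neg, sub_neg_eq_add]

variable [FiniteDimensional ℝ E]

theorem inner_fderiv_expCentroid_nonneg (hK : IsCompact K) (hKi : (interior K).Nonempty)
    (z v : E) : 0 ≤ ⟪fderiv ℝ (expCentroid μ K) z v, v⟫ := by
  have hmono : Monotone fun s : ℝ => ⟪expCentroid μ K (z + s • v), v⟫ := by
    intro s s' hss
    rcases eq_or_ne (z + s' • v) (z + s • v) with h | h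
    · simp only [h, le_refl]
    · have := inner_expCentroid_sub_pos (μ := μ) hK hKi h
      rw [add_sub_add_left_eq_sub, ← sub_smul, real_inner_smul_right, inner_sub_left] at this
      have := (pos_iff_pos_of_mul_pos this).1
        ((sub_nonneg.2 hss).lt_of_ne fun h0 => by simp [← h0] at this)
      simp only
      linarith
  have hd : HasDerivAt (fun s : ℝ => ⟪expCentroid μ K (z + s • v), v⟫)
      ⟪fderiv ℝ (expCentroid μ K) z v, v⟫ 0 := by
    have hl : HasDerivAt (fun s : ℝ => z + s • v) v 0 := by
      simpa using ((hasDerivAt_id (0 : ℝ)).smul_const v).const_add z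
    have hG : HasFDerivAt (expCentroid μ K) (fderiv ℝ (expCentroid μ K) z) (z + (0 : ℝ) • v) := by
      simpa using (differentiable_expCentroid hK hKi z).hasFDerivAt
    simpa using (hG.comp_hasDerivAt 0 hl).inner ℝ (hasDerivAt_const (0 : ℝ) v)
  exact hd.deriv ▸ hmono.deriv_nonneg

/-- Both `z ↦ G(z)` and `z ↦ -G(-z)` are strictly monotone, with `G` the weighted centroid. -/
theorem differenceMap_injective (hK : IsCompact K) (hKi : (interior K).Nonempty) {t : ℝ}
    (ht : 0 ≤ t) : Function.Injective (differenceMap μ K t) := by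
  intro z z' h
  by_contra hz
  have h1 := inner_expCentroid_sub_pos (μ := μ) hK hKi hz
  have h2 := inner_expCentroid_sub_pos (μ := μ) hK hKi (mt neg_inj.1 hz)
  have h3 : ⟪differenceMap μ K t z - differenceMap μ K t z', z - z'⟫ = 0 := by
    rw [h, sub_self, inner_zero_left]
  have h4 : ⟪differenceMap μ K t z - differenceMap μ K t z', z - z'⟫ =
      ⟪expCentroid μ K z - expCentroid μ K z', z - z'⟫ +
        t * ⟪expCentroid μ K (-z) - expCentroid μ K (-z'), -z - -z'⟫ := by
    simp only [differenceMap, inner_sub_left, inner_sub_right, real_inner_smul_left,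
      inner_neg_right]
    ring
  have := mul_nonneg ht h2.le
  linarith

theorem differenceMap_mem (hK : IsCompact K) (hKc : Convex ℝ K) (hKi : (interior K).Nonempty)
    (t : ℝ) (z : E) : differenceMap μ K t z ∈ K + (-t) • K := by
  rw [differenceMap, sub_eq_add_neg, ← neg_smul]
  exact Set.add_mem_add (expCentroid_mem hK hKc hKi z)
    (Set.smul_mem_smul_set (expCentroid_mem hK hKc hKi (-z)))

/-- The map minus `p` is the gradient of `Φ`, which is coercive when `p` is interior; a minimizer of
`Φ` is a preimage of `p`. -/
theorem interior_subset_range_differenceMap (hK : IsCompact K) (hKc : Convex ℝ K)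
    (hKi : (interior K).Nonempty) {t : ℝ} (ht : 0 ≤ t) :
    interior (K + (-t) • K) ⊆ range (differenceMap μ K t) := by
  intro p hp
  obtain ⟨r, hr, hball⟩ := Metric.nhds_basis_closedBall.mem_iff.1 (mem_interior_iff_mem_nhds.1 hp)
  set L : E → ℝ := fun z => Real.log (expMoment μ K (fun _ => (1 : ℝ)) z) with hL
  set Φ : E → ℝ := fun z => L z + t * L (-z) - ⟪p, z⟫ with hΦ
  have hLd := fun z => hasFDerivAt_log_expMoment (μ := μ) hK hKi z
  have hΦd : ∀ z, HasFDerivAt Φ (innerSL ℝ (differenceMap μ K t z - p)) z := by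
    intro z
    have h1 : HasFDerivAt (fun z => L (-z)) (-innerSL ℝ (expCentroid μ K (-z))) z := by
      have := (hLd (-z)).comp z (hasFDerivAt_id z).neg
      simpa [Function.comp_def] using this
    refine (((hLd z).add (h1.const_mul t)).sub
      ((innerSL ℝ p).hasFDerivAt (x := z))).congr_fderiv ?_
    rw [differenceMap, map_sub, map_sub, map_smul, smul_neg, ← sub_eq_add_neg]
  have hΦc : Continuous Φ := continuous_iff_continuousAt.2 fun z => (hΦd z).continuousAt
  -- The two errors then total `(r/2)‖z‖`, half the gain `r‖z‖` from moving `p` by `r` along `z`.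
  obtain ⟨c, hc⟩ := exists_le_log_expMoment (μ := μ) hK hKc hKi
    (ε := r / (2 * (1 + t))) (by positivity)
  have hlow : ∀ z, r / 2 * ‖z‖ - (1 + t) * c ≤ Φ z := by
    intro z
    have hmem : p + (r / ‖z‖) • z ∈ K + (-t) • K := by
      refine hball ?_
      rw [mem_closedBall_iff_norm, add_sub_cancel_left, norm_smul, norm_div, norm_norm,
        Real.norm_eq_abs, abs_of_pos hr]
      rcases eq_or_ne ‖z‖ 0 with h | h
      · rw [h, mul_zero]; exact hr.le
      · rw [div_mul_cancel₀ _ h]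
    obtain ⟨q₁, hq₁, _, ⟨q₂, hq₂, rfl⟩, hq⟩ := hmem
    have h1 := hc z q₁ hq₁
    have h2 := mul_le_mul_of_nonneg_left (hc (-z) q₂ hq₂) ht
    have h3 : ⟪z, q₁⟫ + t * ⟪-z, q₂⟫ = ⟪p, z⟫ + r * ‖z‖ := by
      have := congrArg (fun y => ⟪z, y⟫) hq
      simp only [inner_add_right, real_inner_smul_right, real_inner_self_eq_norm_sq] at this
      rw [inner_neg_left, real_inner_comm z p]
      rcases eq_or_ne ‖z‖ 0 with h0 | h0
      · simp only [h0] at this ⊢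
        simp only [div_zero, zero_mul, mul_zero] at this ⊢
        linarith
      · have h5 : r / ‖z‖ * ‖z‖ ^ 2 = r * ‖z‖ := by field_simp
        linarith
    have h4 : r / (2 * (1 + t)) * ‖z‖ * (1 + t) = r / 2 * ‖z‖ := by
      field_simp
    rw [norm_neg] at h2
    simp only [hΦ, hL]
    linarith
  have hΦt : Tendsto Φ (cocompact E) atTop := by
    refine tendsto_atTop_mono hlow (tendsto_atTop_add_const_right _ _ ?_)
    exact tendsto_norm_cocompact_atTop.const_mul_atTop (by positivity)
  obtain ⟨z, hz⟩ := hΦc.exists_forall_le hΦt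
  have h0 := (show IsLocalMin Φ z from Eventually.of_forall hz).hasFDerivAt_eq_zero (hΦd z)
  refine ⟨z, ?_⟩
  have := congrArg (fun f => f (differenceMap μ K t z - p)) h0
  simp only [innerSL_apply_apply, zero_apply] at this
  exact sub_eq_zero.1 (inner_self_eq_zero.1 this)

theorem det_fderiv_differenceMap_nonneg (hK : IsCompact K) (hKi : (interior K).Nonempty) {t : ℝ}
    (ht : 0 ≤ t) (z : E) :
    0 ≤ (fderiv ℝ (expCentroid μ K) z + t • fderiv ℝ (expCentroid μ K) (-z)).det := by
  refine ContinuousLinearMap.det_nonneg_of_inner_nonneg _ fun v => ?_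
  rw [add_apply, smul_apply, inner_add_left,
    real_inner_smul_left]
  exact add_nonneg (inner_fderiv_expCentroid_nonneg hK hKi z v)
    (mul_nonneg ht (inner_fderiv_expCentroid_nonneg hK hKi (-z) v))

/-- Change of variables: the image lies between `K - tK` and its interior, and the frontier of a
convex set is null. -/
theorem lintegral_det_fderiv_differenceMap (hK : IsCompact K) (hKc : Convex ℝ K)
    (hKi : (interior K).Nonempty) {t : ℝ} (ht : 0 ≤ t) :
    ∫⁻ z, ENNReal.ofReal
      (fderiv ℝ (expCentroid μ K) z + t • fderiv ℝ (expCentroid μ K) (-z)).det ∂μ =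
      μ (K + (-t) • K) := by
  have h := lintegral_abs_det_fderiv_eq_addHaar_image μ MeasurableSet.univ
    (fun z _ => (hasFDerivAt_differenceMap (μ := μ) hK hKi t z).hasFDerivWithinAt)
    (differenceMap_injective hK hKi ht).injOn
  simp only [abs_of_nonneg (det_fderiv_differenceMap_nonneg hK hKi ht _), Measure.restrict_univ,
    image_univ] at h
  rw [h]
  have hM : Convex ℝ (K + (-t) • K) := hKc.add (hKc.smul _)
  refine le_antisymm (measure_mono ?_) ?_
  · rintro _ ⟨z, rfl⟩
    exact differenceMap_mem hK hKc hKi t z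
  · calc μ (K + (-t) • K) ≤ μ (interior (K + (-t) • K) ∪ frontier (K + (-t) • K)) :=
          measure_mono (by
            rw [← closure_eq_interior_union_frontier]; exact subset_closure)
      _ ≤ μ (interior (K + (-t) • K)) + μ (frontier (K + (-t) • K)) := measure_union_le _ _
      _ = μ (interior (K + (-t) • K)) := by rw [hM.addHaar_frontier μ, add_zero]
      _ ≤ _ := measure_mono (interior_subset_range_differenceMap hK hKc hKi ht)

theorem integrable_det_fderiv_differenceMap (hK : IsCompact K) (hKc : Convex ℝ K)
    (hKi : (interior K).Nonempty) {t : ℝ} (ht : 0 ≤ t) :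
    Integrable (fun z => (fderiv ℝ (expCentroid μ K) z +
      t • fderiv ℝ (expCentroid μ K) (-z)).det) μ ∧
    ∫ z, (fderiv ℝ (expCentroid μ K) z + t • fderiv ℝ (expCentroid μ K) (-z)).det ∂μ =
      μ.real (K + (-t) • K) := by
  have hm : Measurable fun z => (fderiv ℝ (expCentroid μ K) z +
      t • fderiv ℝ (expCentroid μ K) (-z)).det := by
    have h1 := measurable_fderiv ℝ (expCentroid μ K)
    exact ContinuousLinearMap.continuous_det.measurable.comp
      (h1.add ((h1.comp measurable_neg).const_smul t))
  have hnn := det_fderiv_differenceMap_nonneg (μ := μ) hK hKi ht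
  have hl := lintegral_det_fderiv_differenceMap (μ := μ) hK hKc hKi ht
  refine ⟨⟨hm.aestronglyMeasurable, ?_⟩, ?_⟩
  · rw [hasFiniteIntegral_iff_ofReal (Eventually.of_forall hnn), hl]
    exact (hK.add (hK.smul (-t))).measure_lt_top
  · rw [integral_eq_lintegral_of_nonneg_ae (Eventually.of_forall hnn) hm.aestronglyMeasurable, hl,
      measureReal_def]

theorem measureReal_add_neg_smul_eq (hE : Module.finrank ℝ E = 3) (hK : IsCompact K)
    (hKc : Convex ℝ K) (hKi : (interior K).Nonempty) {t : ℝ} (ht : 0 ≤ t) :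
    μ.real (K + (-t) • K) =
      -((t - 1) * (t - 2) * (t - 3) / 6) * μ.real K
        + t * (t - 2) * (t - 3) / 2 * μ.real (K + (-1 : ℝ) • K)
        - t * (t - 1) * (t - 3) / 2 * μ.real (K + (-2 : ℝ) • K)
        + t * (t - 1) * (t - 2) / 6 * μ.real (K + (-3 : ℝ) • K) := by
  have h := fun s hs => integrable_det_fderiv_differenceMap (μ := μ) (t := s) hK hKc hKi hs
  obtain ⟨i0, e0⟩ := h 0 le_rfl
  obtain ⟨i1, e1⟩ := h 1 (by norm_num)
  obtain ⟨i2, e2⟩ := h 2 (by norm_num)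
  obtain ⟨i3, e3⟩ := h 3 (by norm_num)
  have hK0 : K + (-0 : ℝ) • K = K := by
    rw [neg_zero, zero_smul_set (hKi.mono interior_subset), add_zero]
  rw [hK0] at e0
  rw [← (h t ht).2, integral_congr_ae (Eventually.of_forall fun z =>
    ContinuousLinearMap.det_add_smul_eq hE _ _ t), integral_add, integral_sub, integral_add,
    integral_const_mul, integral_const_mul, integral_const_mul, integral_const_mul, e0, e1, e2, e3]
  · exact i0.const_mul _
  · exact i1.const_mul _
  · exact (i0.const_mul _).add (i1.const_mul _)
  · exact i2.const_mul _
  · exact ((i0.const_mul _).add (i1.const_mul _)).sub (i2.const_mul _)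
  · exact i3.const_mul _

theorem smul_add_neg_smul {V : Type*} [AddCommGroup V] [Module ℝ V] (K : Set V) {a : ℝ} (ha : a ≠ 0) (b : ℝ) :
    a • K + (-b) • K = a • (K + (-(b / a)) • K) := by
  rw [smul_add, smul_smul]
  congr 2
  field_simp

theorem measureReal_add_neg_smul_symm (hE : Module.finrank ℝ E = 3) (K : Set E) {t : ℝ}
    (ht : 0 < t) : μ.real (K + (-t) • K) = t ^ 3 * μ.real (K + (-t⁻¹) • K) := by
  have h : K + (-t) • K = (-t) • (K + (-t⁻¹) • K) := by
    rw [smul_add, smul_smul, neg_mul_neg, mul_inv_cancel₀ ht.ne', one_smul, add_comm]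
  rw [h, measureReal_def, measureReal_def, Measure.addHaar_smul, hE, ENNReal.toReal_mul,
    ENNReal.toReal_ofReal (abs_nonneg _), abs_pow, abs_neg, abs_of_pos ht]

/-- In dimension three, the volume of the body `(1 + t) K - t K` in terms of the volumes of `K`
and of its difference body. -/
theorem measureReal_one_add_smul_add_neg_smul (hE : Module.finrank ℝ E = 3) (hK : IsCompact K)
    (hKc : Convex ℝ K) (hKi : (interior K).Nonempty) {t : ℝ} (ht : 0 ≤ t) :
    μ.real ((1 + t) • K + (-t) • K) = (1 + 2 * t) * μ.real K +
      t * (1 + t) * (1 + 2 * t) / 2 * μ.real ((1 : ℝ) • K + (-1 : ℝ) • K) := by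
  have hp := fun s hs => measureReal_add_neg_smul_eq (μ := μ) (t := s) hE hK hKc hKi hs
  have hs := fun s hs => measureReal_add_neg_smul_symm (μ := μ) (t := s) hE K hs
  have h2 := hs 2 (by norm_num)
  have h3 := hs 3 (by norm_num)
  -- Interpolation at `1/2` and `1/3`, combined with the symmetry, gives two linear equations that
  -- determine `V2` and `V3` from `V0` and `V1`.
  rw [hp 2⁻¹ (by norm_num)] at h2
  rw [hp 3⁻¹ (by norm_num)] at h3
  have h1t : 0 < 1 + t := by linarith
  rw [smul_add_neg_smul K h1t.ne', measureReal_def, Measure.addHaar_smul, hE, ENNReal.toReal_mul,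
    ENNReal.toReal_ofReal (abs_nonneg _), abs_of_pos (by positivity), ← measureReal_def,
    hp _ (div_nonneg ht h1t.le), one_smul]
  set V0 := μ.real K
  set V1 := μ.real (K + (-1 : ℝ) • K)
  set V2 := μ.real (K + (-2 : ℝ) • K)
  set V3 := μ.real (K + (-3 : ℝ) • K)
  have e2 : V2 = 3 * V0 + 3 * V1 := by linarith
  have e3 : V3 = 16 * V0 + 6 * V1 := by linarith
  rw [e2, e3]
  field_simp
  ring

end VolumePolynomial

/-! ### Volume and volume ratio along the parallel family. -/

theorem measureReal_closedBall_E3 {r : ℝ} (hr : 0 ≤ r) :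
    volume.real (Metric.closedBall (0 : E3) r) = 4 / 3 * Real.pi * r ^ 3 := by
  rw [measureReal_def, EuclideanSpace.volume_closedBall_fin_three, ENNReal.toReal_mul,
    ENNReal.toReal_pow, ENNReal.toReal_ofReal hr, ENNReal.toReal_ofReal (by positivity)]
  ring

theorem HasConstantWidth.measureReal_le {K : ConvexBody E3} {w : ℝ} (h : HasConstantWidth K w) :
    volume.real (K : Set E3) ≤ Real.pi * w ^ 3 / 6 := by
  have hle := volume_le_volume_closedBall_of_dist_le K.isClosed.measurableSet h.1.le
    fun x hx y hy => h.dist_le hx hy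
  calc volume.real (K : Set E3) ≤ volume.real (Metric.closedBall (0 : E3) (w / 2)) :=
        ENNReal.toReal_mono (isCompact_closedBall _ _).measure_ne_top hle
    _ = Real.pi * w ^ 3 / 6 := by
        rw [measureReal_closedBall_E3 (by linarith [h.1])]; ring

theorem HasConstantWidth.eq_of_isParallelBody {K L : ConvexBody E3} {w C : ℝ}
    (hw : HasConstantWidth K w) (hC : 0 ≤ C) (hL : IsParallelBody K C L) :
    L = (1 + C / w) • K + (-(C / w)) • K :=
  ConvexBody.eq_of_supportFn_eq fun u hu => by
    have := hw.isParallelBody (div_nonneg hC hw.1.le) u hu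
    rw [div_mul_cancel₀ _ hw.1.ne'] at this
    rw [hL u hu, this]

theorem HasConstantWidth.measureReal_div_sub_eq_of_nonneg {K L : ConvexBody E3} {w C : ℝ}
    (hw : HasConstantWidth K w) (hC : 0 ≤ C) (hL : IsParallelBody K C L) :
    volume.real (L : Set E3) / (w + 2 * C) - Real.pi * (w + 2 * C) ^ 2 / 6 =
      volume.real (K : Set E3) / w - Real.pi * w ^ 2 / 6 := by
  have hw0 := hw.1
  have hv := measureReal_one_add_smul_add_neg_smul (μ := (volume : Measure E3))
    finrank_euclideanSpace_fin K.isCompact K.convex hw.interior_nonempty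
    (div_nonneg hC hw0.le)
  have hd := congrArg (fun M : ConvexBody E3 => (M : Set E3)) hw.sub_self
  simp only [ConvexBody.coe_add, ConvexBody.coe_smul] at hd
  rw [hd, ← ConvexBody.coe_smul, ← ConvexBody.coe_smul, ← ConvexBody.coe_add,
    ← hw.eq_of_isParallelBody hC hL] at hv
  rw [hv, coe_closedBallBody, measureReal_closedBall_E3 hw0.le]
  have : 0 < w + 2 * C := by linarith
  field_simp
  ring

/-- Along a family of parallel bodies of constant width `w`, the volume is `π w ^ 3 / 6 + b w` with
`b` independent of the width. -/
theorem HasConstantWidth.measureReal_div_sub_eq {K L : ConvexBody E3} {w C : ℝ}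
    (hw : HasConstantWidth K w) (hC : 0 < w + 2 * C) (hL : IsParallelBody K C L) :
    volume.real (L : Set E3) / (w + 2 * C) - Real.pi * (w + 2 * C) ^ 2 / 6 =
      volume.real (K : Set E3) / w - Real.pi * w ^ 2 / 6 := by
  rcases le_total 0 C with h | h
  · exact hw.measureReal_div_sub_eq_of_nonneg h hL
  -- For `C ≤ 0`, `K` is an outer parallel body of `L`.
  · have hK : IsParallelBody L (-C) K := fun u hu => by rw [hL u hu, add_neg_cancel_right]
    have := (hL.hasConstantWidth hw hC).measureReal_div_sub_eq_of_nonneg (neg_nonneg.2 h) hK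
    rw [show w + 2 * C + 2 * -C = w by ring] at this
    exact this.symm

theorem HasConstantWidth.volumeRatio_eq {K L : ConvexBody E3} {w C : ℝ}
    (hw : HasConstantWidth K w) (hC : 0 < w + 2 * C) (hL : IsParallelBody K C L) :
    volumeRatio L (w + 2 * C) =
      1 - 6 / Real.pi * (Real.pi * w ^ 2 / 6 - volume.real (K : Set E3) / w) /
        (w + 2 * C) ^ 2 := by
  have h := hw.measureReal_div_sub_eq hC hL
  rw [← neg_sub (volume.real (K : Set E3) / w), ← h, volumeRatio,
    measureReal_closedBall_E3 (by linarith)]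
  have := Real.pi_pos
  field_simp
  ring

theorem zero_mem_parallelRange {K : ConvexBody E3} {w : ℝ} (hw : HasConstantWidth K w) :
    0 ∈ parallelRange K w :=
  ⟨by linarith [hw.1], K, fun u _ => (add_zero _).symm⟩

theorem isUpperSet_parallelRange {K : ConvexBody E3} {w : ℝ} (hw : HasConstantWidth K w) :
    IsUpperSet (parallelRange K w) := by
  rintro C C' hCC ⟨hC, L, hL⟩
  have hLw := hL.hasConstantWidth hw hC
  refine ⟨by linarith, (1 + (C' - C) / (w + 2 * C)) • L + (-((C' - C) / (w + 2 * C))) • L,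
    fun u hu => ?_⟩
  rw [hLw.isParallelBody (div_nonneg (sub_nonneg.2 hCC) hC.le) u hu, hL u hu,
    div_mul_cancel₀ _ hC.ne']
  ring

theorem theorem4 (K₀ : ConvexBody E3) (w₀ : ℝ) (hw : HasConstantWidth K₀ w₀)
    (hsmooth : IsC2Surface (frontier (K₀ : Set E3)))
    (K : ℝ → ConvexBody E3) (hK : ∀ C ∈ parallelRange K₀ w₀, IsParallelBody K₀ C (K C)) :
    (0 ∈ parallelRange K₀ w₀ ∧ IsUpperSet (parallelRange K₀ w₀)) ∧
    (∀ C ∈ parallelRange K₀ w₀, HasConstantWidth (K C) (w₀ + 2 * C)) ∧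
    (∀ C ∈ parallelRange K₀ w₀,
      DifferentiableWithinAt ℝ (fun t => volumeRatio (K t) (w₀ + 2 * t))
        (parallelRange K₀ w₀) C ∧
      0 ≤ derivWithin (fun t => volumeRatio (K t) (w₀ + 2 * t)) (parallelRange K₀ w₀) C) ∧
    MonotoneOn (fun t => volumeRatio (K t) (w₀ + 2 * t)) (parallelRange K₀ w₀) := by
  -- The isodiametric deficit per unit width; its sign decides the monotonicity.
  set a : ℝ := Real.pi * w₀ ^ 2 / 6 - volume.real (K₀ : Set E3) / w₀ with ha
  have ha0 : 0 ≤ a := by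
    rw [ha, sub_nonneg, div_le_iff₀ hw.1]
    linarith [hw.measureReal_le]
  have heq : EqOn (fun t => volumeRatio (K t) (w₀ + 2 * t))
      (fun t => 1 - 6 / Real.pi * a / (w₀ + 2 * t) ^ 2) (parallelRange K₀ w₀) :=
    fun t ht => hw.volumeRatio_eq ht.1 (hK t ht)
  have hmono : MonotoneOn (fun t => volumeRatio (K t) (w₀ + 2 * t)) (parallelRange K₀ w₀) := by
    refine MonotoneOn.congr (fun s hs t _ hst => ?_) heq.symm
    have hs0 := hs.1
    have := Real.pi_pos
    gcongr
  refine ⟨⟨zero_mem_parallelRange hw, isUpperSet_parallelRange hw⟩,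
    fun C hC => (hK C hC).hasConstantWidth hw hC.1,
    fun C hC => ⟨?_, hmono.derivWithin_nonneg⟩, hmono⟩
  refine DifferentiableWithinAt.congr ?_ (fun t ht => heq ht) (heq hC)
  have hne : (w₀ + 2 * C) ^ 2 ≠ 0 := pow_ne_zero 2 hC.1.ne'
  have hd : DifferentiableAt ℝ (fun t : ℝ => (w₀ + 2 * t) ^ 2) C := by fun_prop
  exact ((differentiableAt_const _).sub ((differentiableAt_const _).div hd hne)).differentiableWithinAt
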